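/- Let $(M,g)$ be an $n$-dimensional (Hausdorff) smooth Riemannian manifold, let $k,p\in\mathbb N$ with $k>0$, $p>1$, $k+p<n-1$, and let $U\subseteq M$ be open. Let $h_1,\dots,h_p\in C^\infty(U,\mathbb R)$ be non-zero smooth functions (none of them vanishes identically on $U$), and let $X_1,\dots,X_k,Y_1,\dots,Y_p\in\mathfrak X(U)$ be smooth vector fields whose values are linearly independent at each point of $U$. Consider the system for $X\in\mathfrak X(U)$ $$g(X,X_1)=\dots=g(X,X_k)=0,\qquad g(X,Y_1)=h_1,\ \dots,\ g(X,Y_p)=h_p. \tag{S}$$ Notation. For an oriented $n$-dimensional Euclidean space $E$ with unit volume element $\mu$, $\Lambda^qE$ carries the inner product $\langle v_1\wedge\dots\wedge v_q,w_1\wedge\dots\wedge w_q\rangle=\det[\langle v_i,w_j\rangle]$, and $\star:\Lambda^qE\to\Lambda^{n-q}E$ is the Hodge star, $\langle\star\nu,\omega\rangle\,\mu=\nu\wedge\omega$ for all $\omega\in\Lambda^{n-q}E$; it is applied in each tangent space. Omitted-factor wedges are taken in increasing order of the index. Put $$X_0=\Big\|\bigwedge_{j=1}^pY_j\wedge\bigwedge_{l=1}^kX_l\Big\|^{-2}\sum_{i=1}^p(-1)^{n-i}h_i\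 \star\Big[\bigwedge_{j\ne i}Y_j\wedge\bigwedge_{l=1}^kX_l\wedge\star\Big(\bigwedge_{j=1}^pY_j\wedge\bigwedge_{l=1}^kX_l\Big)\Big],$$ where any orientation may be used in each tangent space, and $$\mathfrak X[X_1,\dots,X_k,Y_1,\dots,Y_p]=\{X\in\mathfrak X(U): g(X,X_i)=g(X,Y_j)=0 \text{ for all } 1\le i\le k,\ 1\le j\le p\}.$$ For $\mathcal A\subseteq\mathfrak X(U)$ write $\mathcal A_x=\{X(x):X\in\mathcal A\}$. Smooth vector fields $D_0$ and $D_1,\dots,D_r$ on an open $W\subseteq U$, with $D_1,\dots,D_r$ linearly independent at each point of $W$, are local generators of $\mathcal A$ on $W$ if $\mathcal A_y=D_0(y)+\operatorname{span}\{D_1(y),\dots,D_r(y)\}$ for all $y\in W$. The set $\mathcal A$ is an $r$-dimensional smooth affine distribution on $U$ if each point of $U$ has an open neighbourhood $W\subseteq U$ on which $\mathcal A$ has such $1+r$ local generators, and $\mathcal A$ consists of all $X\in\mathfrak X(U)$ with $X(x)\in\mathcal A_x$ for every $x\in U$. Theorem. The set of solutions $X\in\mathfrak X(U)$ of (S) equals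 $X_0+\mathfrak X[X_1,\dots,X_k,Y_1,\dots,Y_p]$, and it is an $[n-(k+p)]$-dimensional smooth affine distribution on $U$. It is locally generated by $X_0$ and the $n-(k+p)$ vector fields $$\star\Big(\bigwedge_{i\ne a}Z_i\wedge\bigwedge_{j=1}^pY_j\wedge\bigwedge_{l=1}^kX_l\Big),\qquad a=1,\dots,n-(k+p).$$ That is, for every open $W\subseteq U$ with any orientation of $W$, and arbitrary $Z_1,\dots,Z_{n-(k+p)}\in\mathfrak X(W)$ such that $X_1,\dots,X_k,Y_1,\dots,Y_p,Z_1,\dots,Z_{n-(k+p)}$ form a moving frame on $W$, these vector fields are local generators of the solution set on $W$. Moreover, each point of $U$ has an open neighbourhood $W\subseteq U$ which is orientable and on which such $Z_1,\dots,Z_{n-(k+p)}$ exist. -/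

import Mathlib

open Bundle
open scoped Manifold ContDiff RealInnerProductSpace

noncomputable section

namespace AffineDist

/-! ### Exterior algebra of an oriented Euclidean space -/

section LinearAlgebra

variable {V : Type*} [NormedAddCommGroup V] [InnerProductSpace ℝ V]

/-- The wedge product `⋀^a V × ⋀^b V → ⋀^(a+b) V`: the product of the exterior algebra. -/
def wedge {a b : ℕ} (ν : ⋀[ℝ]^a V) (ξ : ⋀[ℝ]^b V) : ⋀[ℝ]^(a + b) V :=
  ⟨(ν : ExteriorAlgebra ℝ V) * (ξ : ExteriorAlgebra ℝ V), SetLike.mul_mem_graded ν.2 ξ.2⟩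

/-- The decomposable multivector `⋀_{i ≠ a} v_i`, the factors being taken in increasing order of
the index. -/
def wedgeOmit {m : ℕ} (v : Fin m → V) (a : Fin m) : ⋀[ℝ]^(m - 1) V :=
  exteriorPower.ιMulti ℝ (m - 1)
    (v ∘ (({a}ᶜ : Finset (Fin m)).orderEmbOfFin (by simp [Finset.card_compl])))

variable {n : ℕ} [Fact (Module.finrank ℝ V = n)]

/-- The coefficient of a top-degree multivector with respect to the unit volume element
`μ = e₁ ∧ ⋯ ∧ eₙ`, where `e` is any positively oriented orthonormal basis. -/
def topCoeff (o : Orientation ℝ V (Fin n)) {a b : ℕ} (h : a + b = n) :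
    ⋀[ℝ]^(a + b) V →ₗ[ℝ] ℝ :=
  exteriorPower.alternatingMapLinearEquiv (o.volumeForm.domDomCongr (finCongr h.symm))

variable [FiniteDimensional ℝ V]

/-- The linear functional `α_ν` on `⋀^b V` such that `ν ∧ ξ = α_ν(ξ) μ`. -/
def wedgeFunctional (o : Orientation ℝ V (Fin n)) {a b : ℕ} (h : a + b = n)
    (ν : ⋀[ℝ]^a V) : ⋀[ℝ]^b V →ₗ[ℝ] ℝ where
  toFun ξ := topCoeff o h (wedge ν ξ)
  map_add' ξ₁ ξ₂ := by
    rw [← map_add]; congr 1; ext; simp [wedge, mul_add]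
  map_smul' c ξ := by
    rw [RingHom.id_apply, ← map_smul]; congr 1; ext; simp [wedge]

/-- The Hodge star `⋆ : ⋀^a V → ⋀^b V`, `a + b = n`: by Riesz representation, `⋆ν` is the unique
`b`-vector with `⟨⋆ν, ξ⟩ μ = ν ∧ ξ` for all `ξ`. -/
def hodgeStar (o : Orientation ℝ V (Fin n)) {a b : ℕ} (h : a + b = n)
    (ν : ⋀[ℝ]^a V) : ⋀[ℝ]^b V :=
  (InnerProductSpace.toDual ℝ (⋀[ℝ]^b V)).symm
    (LinearMap.toContinuousLinearMap (wedgeFunctional o h ν))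

theorem inner_hodgeStar (o : Orientation ℝ V (Fin n)) {a b : ℕ} (h : a + b = n)
    (ν : ⋀[ℝ]^a V) (ξ : ⋀[ℝ]^b V) :
    ⟪hodgeStar o h ν, ξ⟫ = topCoeff o h (wedge ν ξ) := by
  simp [hodgeStar, wedgeFunctional]

/-- The Hodge star of an `(n-1)`-vector, viewed as a vector through `⋀^1 V = V`. -/
def hodgeStarVec (o : Orientation ℝ V (Fin n)) {a : ℕ} (h : a + 1 = n)
    (ν : ⋀[ℝ]^a V) : V :=
  exteriorPower.oneEquiv ℝ V (hodgeStar o h ν)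

/-- The multivector `(⋀_j w_j) ∧ (⋀_l v_l)`. -/
def wedgeFamilies {k p : ℕ} (v : Fin k → V) (w : Fin p → V) : ⋀[ℝ]^(p + k) V :=
  wedge (exteriorPower.ιMulti ℝ p w) (exteriorPower.ιMulti ℝ k v)

/-- `Θ_i = ⋆[⋀_{j ≠ i} w_j ∧ ⋀_l v_l ∧ ⋆(⋀_j w_j ∧ ⋀_l v_l)]`. -/
def theta (o : Orientation ℝ V (Fin n)) {k p : ℕ} (hkp : k + p < n)
    (v : Fin k → V) (w : Fin p → V) (i : Fin p) : V :=
  hodgeStarVec o (by have := i.isLt; omega)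
    (wedge (wedge (wedgeOmit w i) (exteriorPower.ιMulti ℝ k v))
      (hodgeStar o (b := n - (k + p)) (by omega) (wedgeFamilies v w)))

/-- The vector `‖⋀ w ∧ ⋀ v‖⁻² ∑_{i=1}^p (-1)^{n-i} λ_i Θ_i`; the index `i : Fin p` starts at `0`,
hence the exponent `n - (i + 1)`. -/
def particular (o : Orientation ℝ V (Fin n)) {k p : ℕ} (hkp : k + p < n)
    (v : Fin k → V) (w : Fin p → V) (c : Fin p → ℝ) : V :=
  (‖wedgeFamilies v w‖ ^ 2)⁻¹ •
    ∑ i : Fin p, ((-1 : ℝ) ^ (n - ((i : ℕ) + 1)) * c i) • theta o hkp v w i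

/-- `⋆(⋀_{i ≠ a} z_i ∧ ⋀_j w_j ∧ ⋀_l v_l)`. -/
def direction (o : Orientation ℝ V (Fin n)) {k p : ℕ} (hkp : k + p < n)
    (v : Fin k → V) (w : Fin p → V) (z : Fin (n - (k + p)) → V) (a : Fin (n - (k + p))) : V :=
  hodgeStarVec o (by omega) (wedge (wedgeOmit z a) (wedgeFamilies v w))

end LinearAlgebra

/-! ### Vector fields on open subsets of a Riemannian manifold -/

section Manifold

variable {n : ℕ} {M : Type*} [TopologicalSpace M] [ChartedSpace (EuclideanSpace ℝ (Fin n)) M]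

instance (x : M) : FiniteDimensional ℝ (TangentSpace (𝓡 n) x) :=
  inferInstanceAs (FiniteDimensional ℝ (EuclideanSpace ℝ (Fin n)))

instance (x : M) : Fact (Module.finrank ℝ (TangentSpace (𝓡 n) x) = n) :=
  ⟨(finrank_euclideanSpace_fin : Module.finrank ℝ (EuclideanSpace ℝ (Fin n)) = n)⟩

variable (n M) in
/-- (Not necessarily smooth) vector fields. A vector field on a subset `U` is represented by such a
function, of which only the values on `U` matter. -/
abbrev VField : Type _ := (x : M) → TangentSpace (𝓡 n) x

variable (n M) in
/-- A choice of orientation of each tangent space (without any continuity). -/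
abbrev PointwiseOrientation : Type _ :=
  (x : M) → Orientation ℝ (TangentSpace (𝓡 n) x) (Fin n)

variable [IsManifold (𝓡 n) ∞ M]

/-- `X ∈ 𝔛(U)`. -/
def IsSmoothOn (U : Set M) (X : VField n M) : Prop :=
  ContMDiffOn (𝓡 n) (𝓡 n).tangent ∞
    (fun x ↦ (⟨x, X x⟩ : TangentBundle (𝓡 n) M)) U

/-- The family `s` is a moving frame on `U`: smooth vector fields on `U` which form a basis of the
tangent space at each point of `U`. -/
abbrev IsMovingFrame {ι : Type*} (U : Set M) (s : ι → VField n M) : Prop :=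
  IsLocalFrameOn (𝓡 n) (EuclideanSpace ℝ (Fin n)) ∞ s U

/-- The pointwise orientation `o` is an orientation of the open set `U`, i.e. around each point of
`U` it is the orientation given by some moving frame. -/
def IsOrientationOn (U : Set M) (o : PointwiseOrientation n M) : Prop :=
  ∀ x ∈ U, ∃ W : Set M, IsOpen W ∧ x ∈ W ∧ W ⊆ U ∧
    ∃ (s : Fin n → VField n M) (hs : IsMovingFrame W s),
      ∀ (y : M) (hy : y ∈ W), (hs.toBasisAt hy).orientation = o y

/-- `𝒜_x = {X(x) : X ∈ 𝒜}`. -/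
def fiberAt (A : Set (VField n M)) (x : M) : Set (TangentSpace (𝓡 n) x) :=
  (fun X : VField n M ↦ X x) '' A

/-- `{X₀} ⊎ {D_1, …, D_r}` is a set of local generators of `𝒜` on `W`: these are smooth vector
fields on `W`, the `D_i` are linearly independent at each point of `W`, and
`𝒜_y = X₀(y) + span {D_1(y), …, D_r(y)}` for all `y ∈ W`. -/
structure IsLocalGenerators {r : ℕ} (A : Set (VField n M)) (W : Set M)
    (X₀ : VField n M) (D : Fin r → VField n M) : Prop where
  smooth_base : IsSmoothOn W X₀
  smooth_dir : ∀ i, IsSmoothOn W (D i)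
  linearIndependent : ∀ y ∈ W, LinearIndependent ℝ (fun i ↦ D i y)
  fiber_eq : ∀ y ∈ W, fiberAt A y =
    (fun u ↦ X₀ y + u) '' (Submodule.span ℝ (Set.range fun i ↦ D i y) : Set (TangentSpace (𝓡 n) y))

/-- `𝒜 ⊆ 𝔛(U)` is an `r`-dimensional smooth affine distribution on `U`: it has a set of
`r + 1` local generators around each point of `U`, and it consists of all the smooth vector fields
on `U` which take their values in the affine subspaces `𝒜_x`. -/
structure IsSmoothAffineDistribution (r : ℕ) (U : Set M) (A : Set (VField n M)) : Prop where
  mem_iff : ∀ X : VField n M, X ∈ A ↔ IsSmoothOn U X ∧ ∀ x ∈ U, X x ∈ fiberAt A x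
  exists_generators : ∀ x ∈ U, ∃ W : Set M, IsOpen W ∧ x ∈ W ∧ W ⊆ U ∧
    ∃ (X₀ : VField n M) (D : Fin r → VField n M), IsLocalGenerators A W X₀ D

variable [RiemannianBundle (fun x : M ↦ TangentSpace (𝓡 n) x)]

/-- The set of solutions `Z ∈ 𝔛(U)` of the system
`g(Z, X_1) = ⋯ = g(Z, X_k) = 0`, `g(Z, Y_1) = h_1, …, g(Z, Y_p) = h_p`. -/
def solutions {k p : ℕ} (U : Set M) (X : Fin k → VField n M) (Y : Fin p → VField n M)
    (h : Fin p → M → ℝ) : Set (VField n M) :=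
  {Z | IsSmoothOn U Z ∧ (∀ i, ∀ x ∈ U, ⟪Z x, X i x⟫ = 0) ∧ ∀ j, ∀ x ∈ U, ⟪Z x, Y j x⟫ = h j x}

/-- `𝔛[X_1, …, X_k, Y_1, …, Y_p]`: the vector fields `Z ∈ 𝔛(U)` with `g(Z, X_i) = g(Z, Y_j) = 0`. -/
def orthogonalFields {k p : ℕ} (U : Set M) (X : Fin k → VField n M) (Y : Fin p → VField n M) :
    Set (VField n M) :=
  {Z | IsSmoothOn U Z ∧ (∀ i, ∀ x ∈ U, ⟪Z x, X i x⟫ = 0) ∧ ∀ j, ∀ x ∈ U, ⟪Z x, Y j x⟫ = 0}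

/-- The vector field
`X₀ = ‖⋀ Y ∧ ⋀ X‖⁻² ∑_{i=1}^p (-1)^{n-i} h_i ⋆[⋀_{j ≠ i} Y_j ∧ ⋀ X ∧ ⋆(⋀ Y ∧ ⋀ X)]`. -/
def baseField (o : PointwiseOrientation n M) {k p : ℕ} (hkp : k + p < n)
    (X : Fin k → VField n M) (Y : Fin p → VField n M) (h : Fin p → M → ℝ) : VField n M :=
  fun x ↦ particular (o x) hkp (fun i ↦ X i x) (fun j ↦ Y j x) (fun j ↦ h j x)

/-- The vector fields `⋆(⋀_{i ≠ a} Z_i ∧ ⋀ Y ∧ ⋀ X)`, `a = 1, …, n - (k + p)`. -/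
def directionField (o : PointwiseOrientation n M) {k p : ℕ} (hkp : k + p < n)
    (X : Fin k → VField n M) (Y : Fin p → VField n M) (Z : Fin (n - (k + p)) → VField n M)
    (a : Fin (n - (k + p))) : VField n M :=
  fun x ↦ direction (o x) hkp (fun i ↦ X i x) (fun j ↦ Y j x) (fun b ↦ Z b x) a

end Manifold

end AffineDist

end

noncomputable section

namespace AffineDist

/-! ### Exterior algebra and the Hodge isometry. -/

section HodgeStar

variable {V : Type*} [NormedAddCommGroup V] [InnerProductSpace ℝ V]

/-! Every vector in sight is understood through its inner product with an arbitrary vector `u`. The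
Hodge star is an isometry (`inner_hodgeStar_hodgeStar`), so `⟪Θ_i, u⟫` is, up to sign, the inner
product of `⋀_{j≠i} w_j ∧ ⋀ v ∧ u` with `⋀ w ∧ ⋀ v` (`inner_theta`). A repeated factor kills it when
`u` is some `v_l` or some `w_j` with `j ≠ i`; for `u = w_i` it is `±‖⋀ w ∧ ⋀ v‖²`, and the signs in
`X₀` are those that make `X₀` a solution. Any other solution differs from it by a field orthogonal
to all `X_i`, `Y_j`.

In the same way, the `a`-th direction pairs with `u` to the volume of `(z_b)_{b≠a}, w, v, u`
(`inner_direction`). The directions are thus orthogonal to `v` and `w`, and biorthogonal to the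
`z_b` up to nonzero factors, so a dimension count makes them a basis of the orthogonal complement of
`v, w`.

Smoothness follows from Cramer's rule in a moving frame: a field is smooth once its inner products
with smooth fields are (`isSmoothOn_of_inner`), and the pairings above are built from the `h_i` and
determinants of inner products, with nowhere zero denominators.

To identify the fibres, each vector orthogonal to the `X_i(x)`, `Y_j(x)` must be the value of an
orthogonal field on all of `U`. A bump function extends the vector; subtracting the base field of an
auxiliary system restores orthogonality without changing the value at `x`
(`exists_mem_orthogonalFields`). -/

theorem coe_wedge {a b : ℕ} (ν : ⋀[ℝ]^a V) (ξ : ⋀[ℝ]^b V) :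
    (wedge ν ξ : ExteriorAlgebra ℝ V) = (ν : ExteriorAlgebra ℝ V) * ξ := rfl

theorem wedge_ιMulti_ιMulti {a b : ℕ} (v : Fin a → V) (w : Fin b → V) :
    wedge (exteriorPower.ιMulti ℝ a v) (exteriorPower.ιMulti ℝ b w) =
      exteriorPower.ιMulti ℝ (a + b) (Fin.append v w) :=
  Subtype.ext (ExteriorAlgebra.ιMulti_mul_ιMulti v w)

theorem comp_append {α β : Type*} {a b : ℕ} (f : α → β) (v : Fin a → α) (w : Fin b → α) :
    f ∘ Fin.append v w = Fin.append (f ∘ v) (f ∘ w) := by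
  ext i
  refine Fin.addCases (fun i ↦ ?_) (fun i ↦ ?_) i <;> simp

theorem ιMulti_comp_cast {a b : ℕ} (h : a = b) (v : Fin b → V) :
    ExteriorAlgebra.ιMulti ℝ a (v ∘ Fin.cast h) = ExteriorAlgebra.ιMulti ℝ b v := by
  subst h; rfl

/-- A vector moves past a multivector of degree `m` at the cost of the sign `(-1)^m`. -/
theorem mul_ι_of_mem_exteriorPower {m : ℕ} {x : ExteriorAlgebra ℝ V}
    (hx : x ∈ ⋀[ℝ]^m V) (u : V) :
    x * ExteriorAlgebra.ι ℝ u = (-1 : ℝ) ^ m • (ExteriorAlgebra.ι ℝ u * x) := by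
  rw [← ExteriorAlgebra.ιMulti_span_fixedDegree] at hx
  induction hx using Submodule.span_induction with
  | mem x hx =>
    obtain ⟨v, rfl⟩ := hx
    induction m with
    | zero => simp
    | succ m ih =>
      have hswap : ExteriorAlgebra.ι ℝ (v 0) * ExteriorAlgebra.ι ℝ u =
          -(ExteriorAlgebra.ι ℝ u * ExteriorAlgebra.ι ℝ (v 0)) :=
        eq_neg_of_add_eq_zero_left (ExteriorAlgebra.ι_add_mul_swap _ _)
      rw [ExteriorAlgebra.ιMulti_succ_apply, mul_assoc, ih, mul_smul_comm, ← mul_assoc, hswap,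
        neg_mul, smul_neg, pow_succ, mul_neg_one, neg_smul, mul_assoc]
  | zero => simp
  | add x y _ _ hx hy => rw [add_mul, hx, hy, mul_add, smul_add]
  | smul c x _ hx => rw [smul_mul_assoc, hx, mul_smul_comm, smul_comm]

variable {n : ℕ} [Fact (Module.finrank ℝ V = n)]

/-- The linear functional on the whole exterior algebra which extends `topCoeff` by zero. -/
def topCoeffAlg (o : Orientation ℝ V (Fin n)) : ExteriorAlgebra ℝ V →ₗ[ℝ] ℝ :=
  ExteriorAlgebra.liftAlternating (Pi.single n o.volumeForm)

theorem topCoeffAlg_ιMulti (o : Orientation ℝ V (Fin n)) (v : Fin n → V) :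
    topCoeffAlg o (ExteriorAlgebra.ιMulti ℝ n v) = o.volumeForm v := by
  simp [topCoeffAlg, ExteriorAlgebra.liftAlternating_apply_ιMulti]

theorem topCoeff_ιMulti (o : Orientation ℝ V (Fin n)) {a b : ℕ} (h : a + b = n)
    (v : Fin (a + b) → V) :
    topCoeff o h (exteriorPower.ιMulti ℝ (a + b) v) = o.volumeForm (v ∘ Fin.cast h.symm) := by
  simp [topCoeff]
  rfl

/-- Passing to the whole algebra lets products be reassociated without transporting between the
degrees `(a + b) + c` and `a + (b + c)`. -/
theorem topCoeff_eq_topCoeffAlg (o : Orientation ℝ V (Fin n)) {a b : ℕ} (h : a + b = n)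
    (x : ⋀[ℝ]^(a + b) V) : topCoeff o h x = topCoeffAlg o x := by
  have : topCoeff o h = topCoeffAlg o ∘ₗ (⋀[ℝ]^(a + b) V).subtype := by
    apply exteriorPower.linearMap_ext
    ext v
    simp only [LinearMap.compAlternatingMap_apply, topCoeff_ιMulti, LinearMap.comp_apply,
      Submodule.subtype_apply, exteriorPower.ιMulti_apply_coe]
    rw [← topCoeffAlg_ιMulti, ιMulti_comp_cast]
  rw [this]; rfl

variable [FiniteDimensional ℝ V]

theorem inner_hodgeStar_ιMulti (o : Orientation ℝ V (Fin n)) {a b : ℕ} (h : a + b = n)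
    (v : Fin a → V) (w : Fin b → V) :
    ⟪hodgeStar o h (exteriorPower.ιMulti ℝ a v), exteriorPower.ιMulti ℝ b w⟫ =
      o.volumeForm (Fin.append v w ∘ Fin.cast h.symm) := by
  rw [inner_hodgeStar, wedge_ιMulti_ιMulti, topCoeff_ιMulti]

/-- The Hodge star as a linear map. -/
def hodgeStarₗ (o : Orientation ℝ V (Fin n)) {a b : ℕ} (h : a + b = n) :
    ⋀[ℝ]^a V →ₗ[ℝ] ⋀[ℝ]^b V where
  toFun := hodgeStar o h
  map_add' x y := by
    refine ext_inner_right ℝ fun ξ ↦ ?_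
    simp only [inner_add_left, inner_hodgeStar, topCoeff_eq_topCoeffAlg, coe_wedge,
      Submodule.coe_add, add_mul, map_add]
  map_smul' c x := by
    refine ext_inner_right ℝ fun ξ ↦ ?_
    simp only [real_inner_smul_left, inner_hodgeStar, topCoeff_eq_topCoeffAlg, coe_wedge,
      Submodule.coe_smul, smul_mul_assoc, map_smul, smul_eq_mul, RingHom.id_apply]

/-- `T` and `Sᶜ` have the same cardinality, so if they differ then `T` meets `S`, and the volume
form is evaluated on a family with a repeated vector. -/
theorem inner_hodgeStar_family_of_ne (o : Orientation ℝ V (Fin n)) {a b : ℕ} (h : a + b = n)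
    (e : Fin n → V) (S : Set.powersetCard (Fin n) a) (T : Set.powersetCard (Fin n) b)
    (hST : (T : Finset (Fin n)) ≠ (S : Finset (Fin n))ᶜ) :
    ⟪hodgeStar o h (exteriorPower.ιMulti_family ℝ a e S),
      exteriorPower.ιMulti_family ℝ b e T⟫ = 0 := by
  rw [exteriorPower.ιMulti_family, exteriorPower.ιMulti_family, inner_hodgeStar_ιMulti]
  have hT : ¬ (T : Finset (Fin n)) ⊆ (S : Finset (Fin n))ᶜ := fun hsub ↦
    hST (Finset.eq_of_subset_of_card_le hsub (by
      rw [Finset.card_compl, Fintype.card_fin, S.2, T.2]; omega))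
  obtain ⟨x, hxT, hxS⟩ := Finset.not_subset.1 hT
  rw [Finset.mem_compl, not_not] at hxS
  obtain ⟨i, hi⟩ := (Set.powersetCard.mem_range_ofFinEmbEquiv_symm_iff_mem S x).2 hxS
  obtain ⟨j, hj⟩ := (Set.powersetCard.mem_range_ofFinEmbEquiv_symm_iff_mem T x).2 hxT
  refine o.volumeForm.map_eq_zero_of_eq _ (i := Fin.cast h (Fin.castAdd b i))
    (j := Fin.cast h (Fin.natAdd a j)) ?_ ?_
  · simp [hi, hj]
  · intro hij
    have := congrArg Fin.val hij
    simp at this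
    omega

/-- The concatenation of `S` and its complement permutes the basis, so the volume is `±1`; squaring
avoids computing the sign of this shuffle. -/
theorem inner_hodgeStar_family_sq (o : Orientation ℝ V (Fin n)) {a b : ℕ} (h : a + b = n)
    (e : OrthonormalBasis (Fin n) ℝ V) (S : Set.powersetCard (Fin n) a)
    (T : Set.powersetCard (Fin n) b) (hST : (T : Finset (Fin n)) = (S : Finset (Fin n))ᶜ) :
    ⟪hodgeStar o h (exteriorPower.ιMulti_family ℝ a e S),
      exteriorPower.ιMulti_family ℝ b e T⟫ ^ 2 = 1 := by
  rw [exteriorPower.ιMulti_family, exteriorPower.ιMulti_family, inner_hodgeStar_ιMulti]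
  let σ : Fin n → Fin n := Fin.append (Set.powersetCard.ofFinEmbEquiv.symm S)
    (Set.powersetCard.ofFinEmbEquiv.symm T) ∘ Fin.cast h.symm
  have hσ : Function.Surjective σ := by
    intro x
    by_cases hx : x ∈ (S : Finset (Fin n))
    · obtain ⟨i, hi⟩ := (Set.powersetCard.mem_range_ofFinEmbEquiv_symm_iff_mem S x).2 hx
      exact ⟨Fin.cast h (Fin.castAdd b i), by simp [σ, hi]⟩
    · have hx' : x ∈ (T : Finset (Fin n)) := by rw [hST]; exact Finset.mem_compl.2 hx
      obtain ⟨i, hi⟩ := (Set.powersetCard.mem_range_ofFinEmbEquiv_symm_iff_mem T x).2 hx'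
      exact ⟨Fin.cast h (Fin.natAdd a i), by simp [σ, hi]⟩
  have hcomp : Fin.append (e ∘ Set.powersetCard.ofFinEmbEquiv.symm S)
      (e ∘ Set.powersetCard.ofFinEmbEquiv.symm T) ∘ Fin.cast h.symm =
      e ∘ Equiv.ofBijective σ (Finite.surjective_iff_bijective.1 hσ) := by
    rw [← comp_append]; rfl
  rw [hcomp, AlternatingMap.map_perm, ← sq_abs]
  rcases Int.units_eq_one_or (Equiv.Perm.sign (Equiv.ofBijective σ
    (Finite.surjective_iff_bijective.1 hσ))) with hs | hs <;>
  simp [hs, o.abs_volumeForm_apply_of_orthonormal e]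

/-- The Hodge star is an isometry. -/
theorem inner_hodgeStar_hodgeStar (o : Orientation ℝ V (Fin n)) {a b : ℕ} (h : a + b = n)
    (ν ξ : ⋀[ℝ]^a V) : ⟪hodgeStar o h ν, hodgeStar o h ξ⟫ = ⟪ν, ξ⟫ := by
  have hn : Module.finrank ℝ V = n := Fact.out
  let e : OrthonormalBasis (Fin n) ℝ V := (stdOrthonormalBasis ℝ V).reindex (finCongr hn)
  have hcoe (m : ℕ) (S : Set.powersetCard (Fin n) m) :
      (e.exteriorPower m) S = exteriorPower.ιMulti_family ℝ m e S := by
    rw [← OrthonormalBasis.coe_toBasis, OrthonormalBasis.toBasis_exteriorPower,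
      exteriorPower.coe_basis, OrthonormalBasis.coe_toBasis]
  have hc : ∀ (S : Set.powersetCard (Fin n) a) (T : Set.powersetCard (Fin n) b), (T : Finset (Fin n)) ≠ (S : Finset (Fin n))ᶜ →
      ⟪hodgeStar o h (e.exteriorPower a S), e.exteriorPower b T⟫ = 0 := fun S T hST ↦ by
    rw [hcoe, hcoe]; exact inner_hodgeStar_family_of_ne o h e S T hST
  have hb : b + a = Fintype.card (Fin n) := by rw [Fintype.card_fin, add_comm, h]
  have horth : Orthonormal ℝ (hodgeStarₗ o h ∘ (e.exteriorPower a).toBasis) := by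
    rw [orthonormal_iff_ite]
    intro S S'
    change ⟪hodgeStar o h ((e.exteriorPower a).toBasis S),
      hodgeStar o h ((e.exteriorPower a).toBasis S')⟫ = _
    -- Parseval in the basis `e_T` of `⋀^b V`: only `T = Sᶜ` can contribute, so `⋆e_S` is `±e_{Sᶜ}`
    -- and the images of the basis vectors are orthonormal.
    rw [OrthonormalBasis.coe_toBasis,
      ← (e.exteriorPower b).sum_inner_mul_inner,
      Finset.sum_eq_single (Set.powersetCard.compl hb S)]
    · split_ifs with hSS
      · subst hSS
        rw [real_inner_comm, ← sq, real_inner_comm, hcoe, hcoe]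
        exact inner_hodgeStar_family_sq o h e S _ Set.powersetCard.coe_compl
      · rw [real_inner_comm (hodgeStar o h (e.exteriorPower a S')), hc S', mul_zero]
        rw [Set.powersetCard.coe_compl, Ne, compl_inj_iff]
        exact fun h' ↦ hSS (Subtype.ext h')
    · intro T _ hT
      rw [hc S T, zero_mul]
      intro h'
      exact hT (Subtype.ext (h'.trans Set.powersetCard.coe_compl.symm))
    · simp
  exact ((hodgeStarₗ o h).isometryOfOrthonormal
    (by rw [OrthonormalBasis.coe_toBasis]; exact (e.exteriorPower a).orthonormal)
    horth).inner_map_map ν ξ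

theorem inner_oneEquiv (ν : ⋀[ℝ]^1 V) (u : V) :
    ⟪exteriorPower.oneEquiv ℝ V ν, u⟫ = ⟪ν, exteriorPower.ιMulti ℝ 1 fun _ ↦ u⟫ := by
  have hν : ν = exteriorPower.ιMulti ℝ 1 fun _ ↦ exteriorPower.oneEquiv ℝ V ν :=
    (exteriorPower.oneEquiv ℝ V).injective (by rw [exteriorPower.oneEquiv_ιMulti])
  conv_rhs => rw [hν]
  rw [exteriorPower.inner_ιMulti_ιMulti]
  simp

theorem inner_hodgeStarVec (o : Orientation ℝ V (Fin n)) {a : ℕ} (h : a + 1 = n)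
    (ν : ⋀[ℝ]^a V) (u : V) :
    ⟪hodgeStarVec o h ν, u⟫ = topCoeffAlg o (ν * ExteriorAlgebra.ι ℝ u) := by
  rw [hodgeStarVec, inner_oneEquiv, inner_hodgeStar, topCoeff_eq_topCoeffAlg, coe_wedge,
    exteriorPower.ιMulti_apply_coe, ExteriorAlgebra.ιMulti_succ_apply]
  simp

end HodgeStar

/-! ### Families with one member omitted or replaced. -/

section Families

variable {α β : Type*}

/-- The family `(w_j)_{j ≠ i}, v, u`. -/
def replaceFamily {k p : ℕ} (v : Fin k → α) (w : Fin p → α) (i : Fin p) (u : α) :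
    Fin (p + k) → α :=
  Fin.append (Fin.append (w ∘ (({i}ᶜ : Finset (Fin p)).orderEmbOfFin
    (k := p - 1) (by simp [Finset.card_compl]))) v) (fun _ : Fin 1 ↦ u) ∘
      Fin.cast (by have := i.isLt; omega)

/-- The family `(z_b)_{b ≠ a}, w, v, u`. -/
def directionFamily {n k p : ℕ} (hkp : k + p < n) (v : Fin k → α) (w : Fin p → α)
    (z : Fin (n - (k + p)) → α) (a : Fin (n - (k + p))) (u : α) : Fin n → α :=
  Fin.append (Fin.append (z ∘ (({a}ᶜ : Finset (Fin (n - (k + p)))).orderEmbOfFin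
    (k := n - (k + p) - 1) (by simp [Finset.card_compl]))) (Fin.append w v)) (fun _ : Fin 1 ↦ u) ∘
      Fin.cast (by omega)

theorem range_append {a b : ℕ} (v : Fin a → α) (w : Fin b → α) :
    Set.range (Fin.append v w) = Set.range v ∪ Set.range w := by
  ext x
  constructor
  · rintro ⟨i, rfl⟩
    refine Fin.addCases (fun i ↦ ?_) (fun i ↦ ?_) i <;> simp
  · rintro (⟨i, rfl⟩ | ⟨i, rfl⟩)
    exacts [⟨Fin.castAdd b i, by simp⟩, ⟨Fin.natAdd a i, by simp⟩]

theorem range_comp_cast {a b : ℕ} (h : a = b) (v : Fin b → α) :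
    Set.range (v ∘ Fin.cast h) = Set.range v := by
  subst h; rfl

theorem range_comp_orderEmbOfFin_compl {m l : ℕ} (z : Fin m → α) (a : Fin m)
    (h : ({a}ᶜ : Finset (Fin m)).card = l) :
    Set.range (z ∘ ({a}ᶜ : Finset (Fin m)).orderEmbOfFin h) = z '' {a}ᶜ := by
  rw [Set.range_comp, Finset.range_orderEmbOfFin]
  simp

theorem range_replaceFamily {k p : ℕ} (v : Fin k → α) (w : Fin p → α) (i : Fin p) (u : α) :
    Set.range (replaceFamily v w i u) = w '' {i}ᶜ ∪ Set.range v ∪ {u} := by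
  rw [replaceFamily, range_comp_cast, range_append, range_append,
    range_comp_orderEmbOfFin_compl, Set.range_const]

theorem range_directionFamily {n k p : ℕ} (hkp : k + p < n) (v : Fin k → α) (w : Fin p → α)
    (z : Fin (n - (k + p)) → α) (a : Fin (n - (k + p))) (u : α) :
    Set.range (directionFamily hkp v w z a u) =
      z '' {a}ᶜ ∪ (Set.range w ∪ Set.range v) ∪ {u} := by
  rw [directionFamily, range_comp_cast, range_append, range_append, range_append,
    range_comp_orderEmbOfFin_compl, Set.range_const]

theorem comp_replaceFamily (f : α → β) {k p : ℕ} (v : Fin k → α) (w : Fin p → α) (i : Fin p)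
    (u : α) : f ∘ replaceFamily v w i u = replaceFamily (f ∘ v) (f ∘ w) i (f u) := by
  rw [replaceFamily, replaceFamily, ← Function.comp_assoc, comp_append, comp_append]
  rfl

theorem comp_directionFamily (f : α → β) {n k p : ℕ} (hkp : k + p < n) (v : Fin k → α)
    (w : Fin p → α) (z : Fin (n - (k + p)) → α) (a : Fin (n - (k + p))) (u : α) :
    f ∘ directionFamily hkp v w z a u = directionFamily hkp (f ∘ v) (f ∘ w) (f ∘ z) a (f u) := by
  rw [directionFamily, directionFamily, ← Function.comp_assoc, comp_append, comp_append,
    comp_append]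
  rfl

theorem append_eq_sumElim {a b : ℕ} (v : Fin a → α) (w : Fin b → α) :
    Fin.append v w = Sum.elim v w ∘ finSumFinEquiv.symm := by
  ext i
  refine Fin.addCases (fun i ↦ ?_) (fun i ↦ ?_) i <;> simp

theorem not_injective_append_const {a : ℕ} {g : Fin a → α} {u : α} (hu : u ∈ Set.range g)
    {m : ℕ} (h : m = a + 1) :
    ¬ Function.Injective (Fin.append g (fun _ : Fin 1 ↦ u) ∘ Fin.cast h) := by
  subst h
  obtain ⟨i, rfl⟩ := hu
  intro hinj
  have := @hinj (Fin.castAdd 1 i) (Fin.natAdd a 0) (by simp)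
  have := congrArg Fin.val this
  simp at this
  omega

end Families

/-! ### Pointwise formulas for the directions and the particular solution. -/

section Formulas

variable {V : Type*} [NormedAddCommGroup V] [InnerProductSpace ℝ V] [FiniteDimensional ℝ V]
  {n : ℕ} [Fact (Module.finrank ℝ V = n)]

/-- Reversing the orientation changes both factors by the same sign, so any orthonormal basis may be
used; there the product is `det (Aᵀ B)` for the coordinate matrices. -/
theorem volumeForm_mul_volumeForm (o : Orientation ℝ V (Fin n)) (v w : Fin n → V) :
    o.volumeForm v * o.volumeForm w = (Matrix.of fun i j ↦ ⟪v i, w j⟫).det := by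
  have hn : Module.finrank ℝ V = n := Fact.out
  let e : OrthonormalBasis (Fin n) ℝ V := (stdOrthonormalBasis ℝ V).reindex (finCongr hn)
  have h : o.volumeForm v * o.volumeForm w = e.toBasis.det v * e.toBasis.det w := by
    by_cases he : e.toBasis.orientation = o
    · rw [o.volumeForm_robust e he]
    · rw [o.volumeForm_robust_neg e he]; simp
  rw [h, Module.Basis.det_apply, Module.Basis.det_apply, ← Matrix.det_transpose,
    ← Matrix.det_mul]
  congr 1
  ext i j
  simp [Matrix.mul_apply, Module.Basis.toMatrix_apply, e.repr_apply_apply]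
  exact (Finset.sum_congr rfl fun l _ ↦ by rw [real_inner_comm]).trans
    (e.sum_inner_mul_inner (v i) (w j))

theorem volumeForm_ne_zero (o : Orientation ℝ V (Fin n)) {v : Fin n → V}
    (hv : LinearIndependent ℝ v) : o.volumeForm v ≠ 0 := by
  have h := volumeForm_mul_volumeForm o v v
  intro h0
  rw [h0, zero_mul] at h
  exact Matrix.det_gram_ne_zero_iff_linearIndependent.2 hv h.symm

theorem inner_direction (o : Orientation ℝ V (Fin n)) {k p : ℕ} (hkp : k + p < n)
    (v : Fin k → V) (w : Fin p → V) (z : Fin (n - (k + p)) → V) (a : Fin (n - (k + p))) (u : V) :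
    ⟪direction o hkp v w z a, u⟫ = o.volumeForm (directionFamily hkp v w z a u) := by
  have hu : ExteriorAlgebra.ι ℝ u = ExteriorAlgebra.ιMulti ℝ 1 fun _ ↦ u := by
    simp
  rw [direction, inner_hodgeStarVec, hu, wedgeFamilies, wedgeOmit, wedge_ιMulti_ιMulti,
    wedge_ιMulti_ιMulti, exteriorPower.ιMulti_apply_coe, ExteriorAlgebra.ιMulti_mul_ιMulti,
    ← topCoeffAlg_ιMulti, directionFamily, ιMulti_comp_cast]

theorem inner_direction_eq_zero (o : Orientation ℝ V (Fin n)) {k p : ℕ} (hkp : k + p < n)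
    (v : Fin k → V) (w : Fin p → V) (z : Fin (n - (k + p)) → V) (a : Fin (n - (k + p))) {u : V}
    (hu : u ∈ z '' {a}ᶜ ∪ (Set.range w ∪ Set.range v)) :
    ⟪direction o hkp v w z a, u⟫ = 0 := by
  rw [inner_direction]
  refine o.volumeForm.map_eq_zero_of_not_injective _ (not_injective_append_const ?_ _)
  rwa [range_append, range_append, range_comp_orderEmbOfFin_compl]

theorem inner_direction_self_ne_zero (o : Orientation ℝ V (Fin n)) {k p : ℕ} (hkp : k + p < n)
    {v : Fin k → V} {w : Fin p → V} {z : Fin (n - (k + p)) → V}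
    (hli : ⊤ ≤ Submodule.span ℝ (Set.range (Sum.elim v (Sum.elim w z))))
    (a : Fin (n - (k + p))) :
    ⟪direction o hkp v w z a, z a⟫ ≠ 0 := by
  rw [inner_direction]
  refine volumeForm_ne_zero o (linearIndependent_of_top_le_span_of_card_eq_finrank
    (hli.trans (Submodule.span_mono ?_)) ?_)
  · rw [range_directionFamily, Set.Sum.elim_range, Set.Sum.elim_range]
    rintro x (hx | hx | ⟨b, rfl⟩)
    · exact Or.inl (Or.inr (Or.inr hx))
    · exact Or.inl (Or.inr (Or.inl hx))
    · by_cases hb : b = a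
      · subst hb; exact Or.inr rfl
      · exact Or.inl (Or.inl ⟨b, hb, rfl⟩)
  · rw [Fintype.card_fin]; exact (Fact.out : Module.finrank ℝ V = n).symm

/-- Pairing a linear relation with `z b` isolates its `b`-th coefficient. -/
theorem linearIndependent_direction (o : Orientation ℝ V (Fin n)) {k p : ℕ} (hkp : k + p < n)
    {v : Fin k → V} {w : Fin p → V} {z : Fin (n - (k + p)) → V}
    (hli : ⊤ ≤ Submodule.span ℝ (Set.range (Sum.elim v (Sum.elim w z)))) :
    LinearIndependent ℝ (direction o hkp v w z) := by
  rw [Fintype.linearIndependent_iff]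
  intro c hc b
  have h := congrArg (fun x ↦ ⟪x, z b⟫) hc
  simp only [sum_inner, real_inner_smul_left, inner_zero_left] at h
  rw [Finset.sum_eq_single b] at h
  · exact (mul_eq_zero.1 h).resolve_right (inner_direction_self_ne_zero o hkp hli b)
  · intro a _ hab
    rw [inner_direction_eq_zero o hkp v w z a (Or.inl ⟨b, fun h' ↦ hab h'.symm, rfl⟩), mul_zero]
  · simp

/-- The span lies in the orthogonal complement of `v, w`, and both have dimension `n - (k + p)`. -/
theorem mem_span_direction_iff (o : Orientation ℝ V (Fin n)) {k p : ℕ} (hkp : k + p < n)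
    {v : Fin k → V} {w : Fin p → V} {z : Fin (n - (k + p)) → V}
    (hvw : LinearIndependent ℝ (Sum.elim v w))
    (hli : ⊤ ≤ Submodule.span ℝ (Set.range (Sum.elim v (Sum.elim w z)))) (u : V) :
    u ∈ Submodule.span ℝ (Set.range (direction o hkp v w z)) ↔
      (∀ i, ⟪u, v i⟫ = 0) ∧ ∀ j, ⟪u, w j⟫ = 0 := by
  set K := Submodule.span ℝ (Set.range (Sum.elim v w)) with hK
  have hmem (x : V) : x ∈ Kᗮ ↔ (∀ i, ⟪x, v i⟫ = 0) ∧ ∀ j, ⟪x, w j⟫ = 0 := by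
    rw [hK, Submodule.mem_orthogonal']
    constructor
    · intro h
      exact ⟨fun i ↦ h _ (Submodule.subset_span ⟨Sum.inl i, rfl⟩),
        fun j ↦ h _ (Submodule.subset_span ⟨Sum.inr j, rfl⟩)⟩
    · rintro ⟨h₁, h₂⟩ y hy
      induction hy using Submodule.span_induction with
      | mem y hy =>
        obtain ⟨i | j, rfl⟩ := hy
        exacts [h₁ i, h₂ j]
      | zero => simp
      | add y y' _ _ hy hy' => rw [inner_add_right, hy, hy', add_zero]
      | smul c y _ hy => rw [real_inner_smul_right, hy, mul_zero]
  have hle : Submodule.span ℝ (Set.range (direction o hkp v w z)) ≤ Kᗮ := by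
    rw [Submodule.span_le]
    rintro _ ⟨a, rfl⟩
    exact (hmem _).2 ⟨fun i ↦ inner_direction_eq_zero o hkp v w z a (Or.inr (Or.inr ⟨i, rfl⟩)),
      fun j ↦ inner_direction_eq_zero o hkp v w z a (Or.inr (Or.inl ⟨j, rfl⟩))⟩
  have hrank := Submodule.finrank_add_finrank_orthogonal K
  rw [hK, finrank_span_eq_card hvw, ← hK, (Fact.out : Module.finrank ℝ V = n)] at hrank
  rw [← hmem, Submodule.eq_of_le_of_finrank_eq hle]
  rw [finrank_span_eq_card (linearIndependent_direction o hkp hli)]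
  simp only [Fintype.card_fin, Fintype.card_sum] at hrank ⊢
  omega

omit [FiniteDimensional ℝ V] in
theorem ιMulti_replaceFamily {k p : ℕ} (v : Fin k → V) (w : Fin p → V) (i : Fin p) (u : V) :
    (exteriorPower.ιMulti ℝ (p + k) (replaceFamily v w i u) : ExteriorAlgebra ℝ V) =
      wedge (wedgeOmit w i) (exteriorPower.ιMulti ℝ k v) * ExteriorAlgebra.ι ℝ u := by
  have hu : ExteriorAlgebra.ι ℝ u = ExteriorAlgebra.ιMulti ℝ 1 fun _ ↦ u := by
    simp
  rw [hu, wedgeOmit, wedge_ιMulti_ιMulti, exteriorPower.ιMulti_apply_coe,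
    exteriorPower.ιMulti_apply_coe, ExteriorAlgebra.ιMulti_mul_ιMulti, replaceFamily,
    ιMulti_comp_cast]

/-- Moving `u` to the left past the inner star, of degree `n - (k + p)`, produces the sign. What
remains is the top coefficient of a multivector wedged with a star, that is, an inner product of two
stars. -/
theorem inner_theta (o : Orientation ℝ V (Fin n)) {k p : ℕ} (hkp : k + p < n)
    (v : Fin k → V) (w : Fin p → V) (i : Fin p) (u : V) :
    ⟪theta o hkp v w i, u⟫ = (-1 : ℝ) ^ (n - (k + p)) *
      ⟪exteriorPower.ιMulti ℝ (p + k) (replaceFamily v w i u), wedgeFamilies v w⟫ := by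
  have h : p + k + (n - (k + p)) = n := by omega
  rw [← inner_hodgeStar_hodgeStar o h, inner_hodgeStar, topCoeff_eq_topCoeffAlg, coe_wedge, ιMulti_replaceFamily,
    theta, inner_hodgeStarVec, coe_wedge, mul_assoc,
    mul_ι_of_mem_exteriorPower (SetLike.coe_mem _), mul_smul_comm, map_smul, smul_eq_mul,
    mul_assoc]

theorem inner_theta_eq_zero (o : Orientation ℝ V (Fin n)) {k p : ℕ} (hkp : k + p < n)
    (v : Fin k → V) (w : Fin p → V) (i : Fin p) {u : V} (hu : u ∈ w '' {i}ᶜ ∪ Set.range v) :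
    ⟪theta o hkp v w i, u⟫ = 0 := by
  rw [inner_theta, (exteriorPower.ιMulti ℝ (p + k)).map_eq_zero_of_not_injective, inner_zero_left,
    mul_zero]
  refine not_injective_append_const ?_ _
  rwa [range_append, range_comp_orderEmbOfFin_compl]

omit [FiniteDimensional ℝ V] in
theorem ιMulti_eq_ι_mul_wedgeOmit {p : ℕ} (w : Fin p → V) (i : Fin p) :
    ExteriorAlgebra.ιMulti ℝ p w = (-1 : ℝ) ^ (i : ℕ) •
      (ExteriorAlgebra.ι ℝ (w i) * (wedgeOmit w i : ExteriorAlgebra ℝ V)) := by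
  obtain _ | p := p
  · exact i.elim0
  have homit : (wedgeOmit w i : ExteriorAlgebra ℝ V) =
      ExteriorAlgebra.ιMulti ℝ p (i.removeNth w) := by
    -- The increasing enumeration of the indices other than `i` is `succAbove`, which links
    -- `wedgeOmit` to `removeNth`.
    have : ⇑(({i}ᶜ : Finset (Fin (p + 1))).orderEmbOfFin (k := p) (by simp [Finset.card_compl])) =
        i.succAbove := by
      symm
      refine Finset.orderEmbOfFin_unique _ (fun j ↦ ?_) (Fin.strictMono_succAbove i)
      simp
    rw [wedgeOmit, exteriorPower.ιMulti_apply_coe]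
    change ExteriorAlgebra.ιMulti ℝ p (w ∘ _) = _
    rw [this]
    rfl
  rw [homit]
  conv_lhs => rw [← Fin.insertNth_self_removeNth i w]
  rw [AlternatingMap.map_insertNth, ExteriorAlgebra.ιMulti_succ_apply]
  rw [← Int.cast_smul_eq_zsmul ℝ]
  simp

omit [FiniteDimensional ℝ V] in
theorem ιMulti_replaceFamily_self {k p : ℕ} (v : Fin k → V) (w : Fin p → V) (i : Fin p) :
    exteriorPower.ιMulti ℝ (p + k) (replaceFamily v w i (w i)) =
      (-1 : ℝ) ^ (k + p - (i + 1)) • wedgeFamilies v w := by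
  -- Bringing the last factor `w i` to the front crosses `p - 1 + k` vectors; putting it back in its
  -- place crosses `i` of them.
  have hsign : (-1 : ℝ) ^ (p - 1 + k) = (-1) ^ (k + p - ((i : ℕ) + 1)) * (-1) ^ (i : ℕ) := by
    have := i.isLt
    rw [← pow_add]
    congr 1
    omega
  apply Subtype.ext
  rw [ιMulti_replaceFamily, mul_ι_of_mem_exteriorPower (SetLike.coe_mem _), Submodule.coe_smul,
    wedgeFamilies, coe_wedge, coe_wedge, exteriorPower.ιMulti_apply_coe,
    exteriorPower.ιMulti_apply_coe, ιMulti_eq_ι_mul_wedgeOmit w i, smul_mul_assoc, smul_smul,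
    mul_assoc, hsign]

theorem norm_wedgeFamilies_sq {k p : ℕ} (v : Fin k → V) (w : Fin p → V) :
    ‖wedgeFamilies v w‖ ^ 2 = (Matrix.gram ℝ (Fin.append w v)).det := by
  rw [← real_inner_self_eq_norm_sq, wedgeFamilies, wedge_ιMulti_ιMulti,
    exteriorPower.inner_ιMulti_self]

omit [FiniteDimensional ℝ V] in
theorem det_gram_append_ne_zero {k p : ℕ} {v : Fin k → V} {w : Fin p → V}
    (hvw : LinearIndependent ℝ (Sum.elim v w)) :
    (Matrix.gram ℝ (Fin.append w v)).det ≠ 0 := by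
  rw [Matrix.det_gram_ne_zero_iff_linearIndependent, append_eq_sumElim]
  have h : Sum.elim w v ∘ finSumFinEquiv.symm =
      Sum.elim v w ∘ (finSumFinEquiv.symm.trans (Equiv.sumComm _ _)) := by
    ext i
    simp only [Function.comp_apply, Equiv.trans_apply]
    rcases finSumFinEquiv.symm i with j | j <;> rfl
  rw [h]
  exact hvw.comp _ (Equiv.injective _)

theorem inner_particular (o : Orientation ℝ V (Fin n)) {k p : ℕ} (hkp : k + p < n)
    (v : Fin k → V) (w : Fin p → V) (c : Fin p → ℝ) (u : V) :
    ⟪particular o hkp v w c, u⟫ = (Matrix.gram ℝ (Fin.append w v)).det⁻¹ *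
      ∑ i : Fin p, ((-1 : ℝ) ^ (n - ((i : ℕ) + 1)) * c i) * ((-1 : ℝ) ^ (n - (k + p)) *
        (Matrix.of fun a b ↦ ⟪replaceFamily v w i u b, Fin.append w v a⟫).det) := by
  rw [particular, real_inner_smul_left, norm_wedgeFamilies_sq, sum_inner]
  congr 1
  refine Finset.sum_congr rfl fun i _ ↦ ?_
  rw [real_inner_smul_left, inner_theta, wedgeFamilies, wedge_ιMulti_ιMulti,
    exteriorPower.inner_ιMulti_ιMulti]

theorem inner_particular_left (o : Orientation ℝ V (Fin n)) {k p : ℕ} (hkp : k + p < n)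
    (v : Fin k → V) (w : Fin p → V) (c : Fin p → ℝ) (l : Fin k) :
    ⟪particular o hkp v w c, v l⟫ = 0 := by
  rw [particular, real_inner_smul_left, sum_inner, Finset.sum_eq_zero, mul_zero]
  intro i _
  rw [real_inner_smul_left, inner_theta_eq_zero o hkp v w i (Or.inr ⟨l, rfl⟩), mul_zero]

theorem inner_particular_right (o : Orientation ℝ V (Fin n)) {k p : ℕ} (hkp : k + p < n)
    {v : Fin k → V} {w : Fin p → V} (hvw : LinearIndependent ℝ (Sum.elim v w))
    (c : Fin p → ℝ) (j : Fin p) :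
    ⟪particular o hkp v w c, w j⟫ = c j := by
  have hne : ‖wedgeFamilies v w‖ ^ 2 ≠ 0 := by
    rw [norm_wedgeFamilies_sq]; exact det_gram_append_ne_zero hvw
  rw [particular, real_inner_smul_left, sum_inner, Finset.sum_eq_single j]
  -- The three exponents add up to `2 (n - (j + 1))`.
  · have hsign : (-1 : ℝ) ^ (n - ((j : ℕ) + 1)) * ((-1) ^ (n - (k + p)) *
        (-1) ^ (k + p - ((j : ℕ) + 1))) = 1 := by
      have := j.isLt
      rw [← pow_add, ← pow_add]
      exact Even.neg_one_pow ⟨n - (j + 1), by omega⟩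
    rw [real_inner_smul_left, inner_theta, ιMulti_replaceFamily_self, real_inner_smul_left,
      real_inner_self_eq_norm_sq]
    rw [inv_mul_eq_iff_eq_mul₀ hne]
    linear_combination c j * ‖wedgeFamilies v w‖ ^ 2 * hsign
  · intro i _ hij
    rw [real_inner_smul_left, inner_theta_eq_zero o hkp v w i
      (Or.inl ⟨j, fun h ↦ hij h.symm, rfl⟩), mul_zero]
  · simp

end Formulas

/-! ### Volume relative to an oriented basis; completion to a basis. -/

section OrientedVolume

variable {V : Type*} [NormedAddCommGroup V] [InnerProductSpace ℝ V] [FiniteDimensional ℝ V]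
  {n : ℕ} [Fact (Module.finrank ℝ V = n)]

omit [FiniteDimensional ℝ V] in
theorem volumeForm_pos_of_orientation_eq (hn : 0 < n) {o : Orientation ℝ V (Fin n)}
    (b : Module.Basis (Fin n) ℝ V) (hb : b.orientation = o) : 0 < o.volumeForm b := by
  have hr : Module.finrank ℝ V = n := Fact.out
  rw [o.volumeForm_robust (o.finOrthonormalBasis hn hr) (o.finOrthonormalBasis_orientation hn hr),
    ← Module.Basis.orientation_eq_iff_det_pos, o.finOrthonormalBasis_orientation hn hr, hb]

/-- Multiply and divide by the volume of `b`, which is the positive root of its Gram determinant.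
The right side involves only inner products, so it varies smoothly along a frame. -/
theorem volumeForm_eq_div_sqrt (hn : 0 < n) {o : Orientation ℝ V (Fin n)}
    (b : Module.Basis (Fin n) ℝ V) (hb : b.orientation = o) (v : Fin n → V) :
    o.volumeForm v =
      (Matrix.of fun i j ↦ ⟪v i, b j⟫).det * (Real.sqrt (Matrix.gram ℝ b).det)⁻¹ := by
  have hpos := volumeForm_pos_of_orientation_eq hn b hb
  have hsqrt : Real.sqrt (Matrix.gram ℝ b).det = o.volumeForm b := by
    rw [Real.sqrt_eq_iff_mul_self_eq_of_pos hpos, volumeForm_mul_volumeForm]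
    rfl
  rw [hsqrt, ← volumeForm_mul_volumeForm o, mul_inv_cancel_right₀ hpos.ne']

theorem exists_span_completion {k p : ℕ} {v : Fin k → V} {w : Fin p → V}
    (hvw : LinearIndependent ℝ (Sum.elim v w)) :
    ∃ z : Fin (n - (k + p)) → V,
      LinearIndependent ℝ (Sum.elim v (Sum.elim w z)) := by
  set K := Submodule.span ℝ (Set.range (Sum.elim v w)) with hK
  have hr : Module.finrank ℝ V = n := Fact.out
  have hrank := Submodule.finrank_add_finrank_orthogonal K
  have hKr : Module.finrank ℝ K = k + p := by
    rw [hK, finrank_span_eq_card hvw]; simp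
  rw [hKr, hr] at hrank
  have hd : Module.finrank ℝ Kᗮ = n - (k + p) := by omega
  let b := Module.finBasisOfFinrankEq ℝ Kᗮ hd
  have hbs : Submodule.span ℝ (Set.range fun i ↦ (b i : V)) = Kᗮ := by
    have := congrArg (Submodule.map Kᗮ.subtype) b.span_eq
    rwa [Submodule.map_span, ← Set.range_comp, Submodule.map_top, Submodule.range_subtype] at this
  refine ⟨fun i ↦ b i, linearIndependent_of_top_le_span_of_card_eq_finrank ?_ ?_⟩
  · rw [Set.Sum.elim_range, Set.Sum.elim_range, ← Set.union_assoc, ← Set.Sum.elim_range,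
      Submodule.span_union, hbs, ← hK, Submodule.sup_orthogonal_of_hasOrthogonalProjection]
  · simp only [Fintype.card_sum, Fintype.card_fin, hr]
    omega

end OrientedVolume

/-! ### Smoothness of vector fields through inner products. -/

section SmoothFields

variable {n : ℕ} {M : Type*} [TopologicalSpace M] [ChartedSpace (EuclideanSpace ℝ (Fin n)) M]

theorem contMDiffOn_det {ι : Type*} [Fintype ι] [DecidableEq ι] {U : Set M}
    {A : M → Matrix ι ι ℝ} (hA : ∀ i j, ContMDiffOn (𝓡 n) 𝓘(ℝ) ∞ (fun x ↦ A x i j) U) :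
    ContMDiffOn (𝓡 n) 𝓘(ℝ) ∞ (fun x ↦ (A x).det) U := by
  simp only [Matrix.det_apply']
  exact contMDiffOn_finsetSum fun σ _ ↦
    contMDiffOn_const.mul (contMDiffOn_finsetProd fun i _ ↦ hA _ _)

variable [IsManifold (𝓡 n) ∞ M]

theorem exists_isMovingFrame (x : M) : ∃ W : Set M, IsOpen W ∧ x ∈ W ∧
    ∃ s : Fin n → VField n M, IsMovingFrame W s :=
  let e := trivializationAt (EuclideanSpace ℝ (Fin n)) (TangentSpace (𝓡 n) : M → Type _) x
  ⟨e.baseSet, e.open_baseSet, FiberBundle.mem_baseSet_trivializationAt' x,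
    e.localFrame (EuclideanSpace.basisFun (Fin n) ℝ).toBasis,
    e.isLocalFrameOn_localFrame_baseSet (𝓡 n) ∞ (EuclideanSpace.basisFun (Fin n) ℝ).toBasis⟩

theorem exists_smooth_extension [T2Space M] (x : M) (u : TangentSpace (𝓡 n) x) :
    ∃ E : VField n M, IsSmoothOn Set.univ E ∧ E x = u := by
  obtain ⟨s, hs, hsm⟩ := FiberBundle.exists_contMDiffOn_extend (𝓡 n) (EuclideanSpace ℝ (Fin n))
    (V := (TangentSpace (𝓡 n) : M → Type _)) (k := ∞) u
  obtain ⟨N, hNs, hN, hxN⟩ := mem_nhds_iff.1 hs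
  -- `hφ` places the closed support of `φ` inside `N`, so that the product with the local extension
  -- is smooth on all of `M`.
  obtain ⟨φ, hφ, -⟩ := (SmoothBumpFunction.nhds_basis_support (I := 𝓡 n)
    (hN.mem_nhds hxN)).mem_iff.1 (hN.mem_nhds hxN)
  refine ⟨(φ : M → ℝ) • FiberBundle.extend (EuclideanSpace ℝ (Fin n)) u, ?_, ?_⟩
  · exact (ContMDiffOn.smul_section_of_tsupport φ.contMDiff.contMDiffOn hN hφ
      (hsm.mono hNs)).contMDiffOn
  · simp

variable [RiemannianBundle (fun x : M ↦ TangentSpace (𝓡 n) x)]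
    [IsContMDiffRiemannianBundle (𝓡 n) ∞ (EuclideanSpace ℝ (Fin n))
      (fun x : M ↦ TangentSpace (𝓡 n) x)]

theorem IsSmoothOn.inner {U : Set M} {X Y : VField n M} (hX : IsSmoothOn U X)
    (hY : IsSmoothOn U Y) : ContMDiffOn (𝓡 n) 𝓘(ℝ) ∞ (fun x ↦ ⟪X x, Y x⟫) U :=
  ContMDiffOn.inner_bundle hX hY

theorem contMDiffOn_det_gram {ι : Type*} [Fintype ι] [DecidableEq ι] {U : Set M}
    {s : ι → VField n M} (hs : ∀ i, IsSmoothOn U (s i)) :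
    ContMDiffOn (𝓡 n) 𝓘(ℝ) ∞ (fun x ↦ (Matrix.gram ℝ fun i ↦ s i x).det) U :=
  contMDiffOn_det fun i j ↦ (hs i).inner (hs j)

/-- The frame coefficients of `Z` solve a linear system whose matrix is the invertible Gram matrix;
Cramer's rule gives them as quotients of smooth determinants. -/
theorem IsMovingFrame.isSmoothOn_of_inner {ι : Type*} [Fintype ι] [DecidableEq ι] {W : Set M}
    {s : ι → VField n M} (hs : IsMovingFrame W s) {Z : VField n M}
    (hZ : ∀ i, ContMDiffOn (𝓡 n) 𝓘(ℝ) ∞ (fun x ↦ ⟪s i x, Z x⟫) W) : IsSmoothOn W Z := by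
  refine hs.contMDiffOn_of_coeff fun i ↦ ?_
  have hG : ∀ x ∈ W, (Matrix.gram ℝ fun i ↦ s i x).det ≠ 0 := fun x hx ↦
    Matrix.det_gram_ne_zero_iff_linearIndependent.2 (hs.linearIndependent hx)
  have hnum : ContMDiffOn (𝓡 n) 𝓘(ℝ) ∞ (fun x ↦ ((Matrix.gram ℝ fun i ↦ s i x).updateCol i
      fun j ↦ ⟪s j x, Z x⟫).det) W := by
    refine contMDiffOn_det fun j l ↦ ?_
    simp only [Matrix.updateCol_apply]
    split_ifs
    · exact hZ j
    · exact IsSmoothOn.inner (hs.contMDiffOn j) (hs.contMDiffOn l)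
  refine (((contMDiffOn_det_gram hs.contMDiffOn).inv₀ hG).mul hnum).congr fun x hx ↦ ?_
  have hcoeff : (fun j ↦ ⟪s j x, Z x⟫) =
      (Matrix.gram ℝ fun i ↦ s i x).mulVec fun l ↦ hs.coeff l x (Z x) := by
    ext j
    conv_lhs => rw [hs.coeff_sum_eq Z hx, inner_sum]
    simp [Matrix.mulVec, dotProduct, real_inner_smul_right, mul_comm]
  change hs.coeff i x (Z x) = (Matrix.gram ℝ fun i ↦ s i x).det⁻¹ *
    ((Matrix.gram ℝ fun i ↦ s i x).updateCol i fun j ↦ ⟪s j x, Z x⟫).det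
  rw [eq_inv_mul_iff_mul_eq₀ (hG x hx), ← Matrix.cramer_apply, hcoeff,
    Matrix.cramer_eq_adjugate_mulVec, Matrix.mulVec_mulVec, Matrix.adjugate_mul,
    Matrix.smul_mulVec, Matrix.one_mulVec, Pi.smul_apply, smul_eq_mul]

theorem isSmoothOn_of_inner {U : Set M} {Z : VField n M}
    (hZ : ∀ V ⊆ U, IsOpen V → ∀ u : VField n M, IsSmoothOn V u →
      ContMDiffOn (𝓡 n) 𝓘(ℝ) ∞ (fun x ↦ ⟪Z x, u x⟫) V) (hU : IsOpen U) : IsSmoothOn U Z := by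
  refine contMDiffOn_of_locally_contMDiffOn fun x hx ↦ ?_
  obtain ⟨W, hW, hxW, s, hs⟩ := exists_isMovingFrame (n := n) x
  refine ⟨W, hW, hxW, ?_⟩
  have hs' : IsMovingFrame (U ∩ W) s := hs.mono Set.inter_subset_right
  refine hs'.isSmoothOn_of_inner fun i ↦ ?_
  simp only [real_inner_comm]
  exact hZ _ Set.inter_subset_left (hU.inter hW) _ (hs'.contMDiffOn i)

variable {k p : ℕ}

/-- The star occurs twice, so `inner_particular` contains no volume form and the orientations `o x`
may vary without any continuity. -/
theorem isSmoothOn_baseField (hkp : k + p < n) {U : Set M} (hU : IsOpen U) {h : Fin p → M → ℝ}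
    (hh : ∀ j, ContMDiffOn (𝓡 n) 𝓘(ℝ) ∞ (h j) U) {X : Fin k → VField n M}
    {Y : Fin p → VField n M} (hX : ∀ i, IsSmoothOn U (X i)) (hY : ∀ j, IsSmoothOn U (Y j))
    (hXY : ∀ x ∈ U, LinearIndependent ℝ (Sum.elim (fun i ↦ X i x) (fun j ↦ Y j x)))
    (o : PointwiseOrientation n M) : IsSmoothOn U (baseField o hkp X Y h) := by
  refine isSmoothOn_of_inner (fun V hVU _ u hu ↦ ?_) hU
  have happ (a : Fin (p + k)) : IsSmoothOn V (Fin.append Y X a) := by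
    have : Fin.append Y X a ∈ Set.range (Fin.append Y X) := ⟨a, rfl⟩
    rw [range_append] at this
    obtain ⟨j, hj⟩ | ⟨i, hi⟩ := this
    · rw [← hj]; exact (hY j).mono hVU
    · rw [← hi]; exact (hX i).mono hVU
  have hrep (i : Fin p) (a : Fin (p + k)) : IsSmoothOn V (replaceFamily X Y i u a) := by
    have : replaceFamily X Y i u a ∈ Set.range (replaceFamily X Y i u) := ⟨a, rfl⟩
    rw [range_replaceFamily] at this
    obtain (⟨j, -, hj⟩ | ⟨l, hl⟩) | ha := this
    · rw [← hj]; exact (hY j).mono hVU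
    · rw [← hl]; exact (hX l).mono hVU
    · rw [Set.mem_singleton_iff.1 ha]; exact hu
  -- Evaluation at `x` commutes with forming the families, so each entry is one fixed smooth field.
  have hev (x : M) : Fin.append (fun j ↦ Y j x) (fun i ↦ X i x) = fun a ↦ Fin.append Y X a x :=
    (comp_append (fun E : VField n M ↦ E x) Y X).symm
  have hev' (x : M) (i : Fin p) : replaceFamily (fun i ↦ X i x) (fun j ↦ Y j x) i (u x) =
      fun a ↦ replaceFamily X Y i u a x :=
    (comp_replaceFamily (fun E : VField n M ↦ E x) X Y i u).symm
  simp only [baseField, inner_particular, hev, hev']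
  refine ((contMDiffOn_det_gram happ).inv₀ fun x hx ↦ ?_).mul (contMDiffOn_finsetSum fun i _ ↦ ?_)
  · rw [← hev]
    exact det_gram_append_ne_zero (hXY x (hVU hx))
  · exact (contMDiffOn_const.mul ((hh i).mono hVU)).mul
      (contMDiffOn_const.mul (contMDiffOn_det fun a b ↦ (hrep i b).inner (happ a)))

/-- Only one star occurs here, so the sign depends on the orientation; near each point it is that of
a frame, and `volumeForm_eq_div_sqrt` applies. -/
theorem isSmoothOn_directionField (hkp : k + p < n) {W : Set M} (hW : IsOpen W)
    {X : Fin k → VField n M} {Y : Fin p → VField n M} {Z : Fin (n - (k + p)) → VField n M}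
    (hX : ∀ i, IsSmoothOn W (X i)) (hY : ∀ j, IsSmoothOn W (Y j)) (hZ : ∀ b, IsSmoothOn W (Z b))
    {o : PointwiseOrientation n M} (ho : IsOrientationOn W o) (a : Fin (n - (k + p))) :
    IsSmoothOn W (directionField o hkp X Y Z a) := by
  refine isSmoothOn_of_inner (fun V hVW _ u hu ↦ ?_) hW
  refine contMDiffOn_of_locally_contMDiffOn fun x hx ↦ ?_
  obtain ⟨N, hN, hxN, -, s, hs, hso⟩ := ho x (hVW hx)
  refine ⟨N, hN, hxN, ?_⟩
  have hfam (i : Fin n) : IsSmoothOn (V ∩ N) (directionFamily hkp X Y Z a u i) := by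
    have hsub : V ∩ N ⊆ W := Set.inter_subset_left.trans hVW
    have : directionFamily hkp X Y Z a u i ∈ Set.range (directionFamily hkp X Y Z a u) := ⟨i, rfl⟩
    rw [range_directionFamily] at this
    obtain (⟨b, -, hb⟩ | ⟨j, hj⟩ | ⟨l, hl⟩) | ha := this
    · rw [← hb]; exact (hZ b).mono hsub
    · rw [← hj]; exact (hY j).mono hsub
    · rw [← hl]; exact (hX l).mono hsub
    · rw [Set.mem_singleton_iff.1 ha]; exact hu.mono Set.inter_subset_left
  have hs' (i : Fin n) : IsSmoothOn (V ∩ N) (s i) := (hs.contMDiffOn i).mono Set.inter_subset_right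
  have hpos : ∀ y ∈ V ∩ N, 0 < (Matrix.gram ℝ fun i ↦ s i y).det := fun y hy ↦
    (Matrix.posDef_gram_of_linearIndependent (hs.linearIndependent hy.2)).det_pos
  have hsqrt : ContMDiffOn (𝓡 n) 𝓘(ℝ) ∞
      (fun y ↦ Real.sqrt (Matrix.gram ℝ fun i ↦ s i y).det) (V ∩ N) := fun y hy ↦
    (Real.contDiffAt_sqrt (hpos y hy).ne').contMDiffAt.comp_contMDiffWithinAt y
      (contMDiffOn_det_gram hs' y hy)
  refine ((contMDiffOn_det fun i j ↦ (hfam i).inner (hs' j)).mul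
    (hsqrt.inv₀ fun y hy ↦ (Real.sqrt_pos.2 (hpos y hy)).ne')).congr fun y hy ↦ ?_
  have hn : 0 < n := by omega
  have hb : ⇑(hs.toBasisAt hy.2) = fun i ↦ s i y := funext fun i ↦ hs.toBasisAt_coe hy.2 i
  have hev : directionFamily hkp (fun i ↦ X i y) (fun j ↦ Y j y) (fun b ↦ Z b y) a (u y) =
      fun i ↦ directionFamily hkp X Y Z a u i y :=
    (comp_directionFamily (fun E : VField n M ↦ E y) hkp X Y Z a u).symm
  rw [directionField, inner_direction, volumeForm_eq_div_sqrt hn _ (hso y hy.2), hb, hev]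
  rfl

end SmoothFields

/-! ### Completed frames, fibres and the solution set. -/

section Solutions

variable {n : ℕ} {M : Type*} [TopologicalSpace M] [ChartedSpace (EuclideanSpace ℝ (Fin n)) M]
  [IsManifold (𝓡 n) ∞ M]

theorem exists_isOrientationOn {ι : Type*} [Fintype ι] {W : Set M} (hW : IsOpen W)
    {s : ι → VField n M} (hs : IsMovingFrame W s) (hι : Fintype.card ι = n)
    (o : PointwiseOrientation n M) : ∃ o' : PointwiseOrientation n M, IsOrientationOn W o' := by
  classical
  let f : Fin n ≃ ι := (Fintype.equivFinOfCardEq hι).symm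
  have hs' : IsMovingFrame W (s ∘ f) :=
    { linearIndependent := fun hx ↦ (hs.linearIndependent hx).comp f f.injective
      generating := fun {x} hx ↦ by
        have h : Set.range (fun i ↦ (s ∘ f) i x) = Set.range fun i ↦ s i x :=
          f.surjective.range_comp fun i ↦ s i x
        rw [h]; exact hs.generating hx
      contMDiffOn := fun i ↦ hs.contMDiffOn (f i) }
  -- The values off `W` are irrelevant; `o` only supplies a default there.
  refine ⟨fun y ↦ if hy : y ∈ W then (hs'.toBasisAt hy).orientation else o y, fun x hx ↦
    ⟨W, hW, hx, subset_rfl, s ∘ f, hs', fun y hy ↦ ?_⟩⟩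
  simp [hy]

variable [RiemannianBundle (fun x : M ↦ TangentSpace (𝓡 n) x)]
    [IsContMDiffRiemannianBundle (𝓡 n) ∞ (EuclideanSpace ℝ (Fin n))
      (fun x : M ↦ TangentSpace (𝓡 n) x)]

variable {k p : ℕ} {U : Set M} {X : Fin k → VField n M} {Y : Fin p → VField n M}

/-- A basis completion at `x`, extended smoothly, stays independent on the open set where the Gram
determinant is nonzero. -/
theorem exists_movingFrame_completion [T2Space M] (hU : IsOpen U)
    (hX : ∀ i, IsSmoothOn U (X i)) (hY : ∀ j, IsSmoothOn U (Y j))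
    (hXY : ∀ x ∈ U, LinearIndependent ℝ (Sum.elim (fun i ↦ X i x) (fun j ↦ Y j x)))
    (hkp : k + p < n) {x : M} (hx : x ∈ U) :
    ∃ W : Set M, IsOpen W ∧ x ∈ W ∧ W ⊆ U ∧ ∃ Z : Fin (n - (k + p)) → VField n M,
      IsMovingFrame W (Sum.elim X (Sum.elim Y Z)) := by
  obtain ⟨z, hz⟩ := exists_span_completion (n := n) (hXY x hx)
  choose Z hZ hZx using fun b ↦ exists_smooth_extension x (z b)
  have hev (y : M) : (fun i ↦ Sum.elim X (Sum.elim Y Z) i y) = Sum.elim (fun i ↦ X i y)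
      (Sum.elim (fun j ↦ Y j y) fun b ↦ Z b y) := by
    ext (i | j | b) <;> rfl
  have hs (i) : IsSmoothOn U (Sum.elim X (Sum.elim Y Z) i) := by
    obtain i | j | b := i
    exacts [hX i, hY j, (hZ b).mono (Set.subset_univ _)]
  refine ⟨U ∩ (fun y ↦ (Matrix.gram ℝ fun i ↦ Sum.elim X (Sum.elim Y Z) i y).det) ⁻¹' {0}ᶜ,
    (contMDiffOn_det_gram hs).continuousOn.isOpen_inter_preimage hU isOpen_compl_singleton,
    ⟨hx, ?_⟩, Set.inter_subset_left, Z, ?_⟩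
  · rw [Set.mem_preimage, Set.mem_compl_singleton_iff,
      Matrix.det_gram_ne_zero_iff_linearIndependent, hev]
    simpa only [hZx] using hz
  · have hli {y : M} (hy : y ∈ U ∩ (fun y ↦ (Matrix.gram ℝ fun i ↦
        Sum.elim X (Sum.elim Y Z) i y).det) ⁻¹' {0}ᶜ) :
        LinearIndependent ℝ fun i ↦ Sum.elim X (Sum.elim Y Z) i y :=
      Matrix.det_gram_ne_zero_iff_linearIndependent.1 hy.2
    refine ⟨fun hy ↦ hli hy, fun {y} hy ↦ ?_, fun i ↦ (hs i).mono Set.inter_subset_left⟩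
    refine ((hli hy).span_eq_top_of_card_eq_finrank' ?_).ge
    simp only [Fintype.card_sum, Fintype.card_fin]
    rw [(Fact.out : Module.finrank ℝ (TangentSpace (𝓡 n) y) = n)]
    omega

/-- The orthogonal projection of an extension `E` of `u`. The component to be removed is the base
field of the system with no homogeneous equations and right-hand sides `⟪E, X i⟫`, `⟪E, Y j⟫`; these
vanish at `x`, so the value `u` survives. -/
theorem exists_mem_orthogonalFields [T2Space M] (hU : IsOpen U)
    (hX : ∀ i, IsSmoothOn U (X i)) (hY : ∀ j, IsSmoothOn U (Y j))
    (hXY : ∀ x ∈ U, LinearIndependent ℝ (Sum.elim (fun i ↦ X i x) (fun j ↦ Y j x)))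
    (hkp : k + p < n) (o : PointwiseOrientation n M) {x : M}
    {u : TangentSpace (𝓡 n) x} (huX : ∀ i, ⟪u, X i x⟫ = 0) (huY : ∀ j, ⟪u, Y j x⟫ = 0) :
    ∃ E ∈ orthogonalFields U X Y, E x = u := by
  obtain ⟨E, hE, hEx⟩ := exists_smooth_extension x u
  have hkp' : 0 + (k + p) < n := by omega
  have hs (j) : IsSmoothOn U (Fin.append X Y j) := by
    refine Fin.addCases (fun j ↦ ?_) (fun j ↦ ?_) j
    · rw [Fin.append_left]; exact hX j
    · rw [Fin.append_right]; exact hY j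
  let N : Fin 0 → VField n M := fun i ↦ i.elim0
  have hli (y : M) (hy : y ∈ U) :
      LinearIndependent ℝ (Sum.elim (fun i ↦ N i y) fun j ↦ Fin.append X Y j y) := by
    have h : Sum.elim (fun i ↦ N i y) (fun j ↦ Fin.append X Y j y) =
        Sum.elim (fun i ↦ X i y) (fun j ↦ Y j y) ∘
          (Equiv.emptySum (Fin 0) (Fin (k + p))).trans finSumFinEquiv.symm := by
      ext (i | j)
      · exact i.elim0
      · refine Fin.addCases (fun j ↦ ?_) (fun j ↦ ?_) j <;> simp
    rw [h]
    exact (hXY y hy).comp _ (Equiv.injective _)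
  let c : Fin (k + p) → M → ℝ := fun j y ↦ ⟪E y, Fin.append X Y j y⟫
  have hEU : IsSmoothOn U E := hE.mono (Set.subset_univ _)
  let P := baseField o hkp' N (Fin.append X Y) c
  have hP : IsSmoothOn U P := isSmoothOn_baseField hkp' hU (fun j ↦ hEU.inner (hs j))
    (fun i ↦ i.elim0) hs hli o
  have hPc (j) (y : M) (hy : y ∈ U) : ⟪P y, Fin.append X Y j y⟫ = c j y :=
    inner_particular_right (o y) hkp' (hli y hy) (fun j ↦ c j y) j
  have horth (j) (y : M) (hy : y ∈ U) : ⟪(E - P) y, Fin.append X Y j y⟫ = 0 := by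
    rw [Pi.sub_apply, inner_sub_left, hPc j y hy, sub_self]
  refine ⟨E - P, ⟨ContMDiffOn.sub_section hEU hP, fun i y hy ↦ ?_, fun j y hy ↦ ?_⟩, ?_⟩
  · simpa using horth (Fin.castAdd p i) y hy
  · simpa using horth (Fin.natAdd k j) y hy
  · have hc (j) : c j x = 0 := by
      refine Fin.addCases (fun j ↦ ?_) (fun j ↦ ?_) j
      · simpa [c, hEx] using huX j
      · simpa [c, hEx] using huY j
    have hPx : P x = 0 := by
      simp only [P, baseField, particular, hc, mul_zero, zero_smul, Finset.sum_const_zero,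
        smul_zero]
    rw [Pi.sub_apply, hPx, sub_zero, hEx]

variable {h : Fin p → M → ℝ}

theorem baseField_mem_solutions (hkp : k + p < n) (hU : IsOpen U)
    (hh : ∀ j, ContMDiffOn (𝓡 n) 𝓘(ℝ) ∞ (h j) U)
    (hX : ∀ i, IsSmoothOn U (X i)) (hY : ∀ j, IsSmoothOn U (Y j))
    (hXY : ∀ x ∈ U, LinearIndependent ℝ (Sum.elim (fun i ↦ X i x) (fun j ↦ Y j x)))
    (o : PointwiseOrientation n M) : baseField o hkp X Y h ∈ solutions U X Y h :=
  ⟨isSmoothOn_baseField hkp hU hh hX hY hXY o,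
    fun i x _ ↦ inner_particular_left (o x) hkp _ _ _ i,
    fun j x hx ↦ inner_particular_right (o x) hkp (hXY x hx) _ j⟩

omit [IsContMDiffRiemannianBundle (𝓡 n) ∞ (EuclideanSpace ℝ (Fin n))
  (fun x : M ↦ TangentSpace (𝓡 n) x)] in
theorem add_mem_solutions {Z E : VField n M} (hZ : Z ∈ solutions U X Y h)
    (hE : E ∈ orthogonalFields U X Y) : Z + E ∈ solutions U X Y h :=
  ⟨ContMDiffOn.add_section hZ.1 hE.1,
    fun i x hx ↦ by rw [Pi.add_apply, inner_add_left, hZ.2.1 i x hx, hE.2.1 i x hx, add_zero],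
    fun j x hx ↦ by rw [Pi.add_apply, inner_add_left, hZ.2.2 j x hx, hE.2.2 j x hx, add_zero]⟩

omit [IsContMDiffRiemannianBundle (𝓡 n) ∞ (EuclideanSpace ℝ (Fin n))
  (fun x : M ↦ TangentSpace (𝓡 n) x)] in
theorem sub_mem_orthogonalFields {Z Z' : VField n M} (hZ : Z ∈ solutions U X Y h)
    (hZ' : Z' ∈ solutions U X Y h) : Z - Z' ∈ orthogonalFields U X Y :=
  ⟨ContMDiffOn.sub_section hZ.1 hZ'.1,
    fun i x hx ↦ by rw [Pi.sub_apply, inner_sub_left, hZ.2.1 i x hx, hZ'.2.1 i x hx, sub_zero],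
    fun j x hx ↦ by rw [Pi.sub_apply, inner_sub_left, hZ.2.2 j x hx, hZ'.2.2 j x hx, sub_self]⟩

omit [IsContMDiffRiemannianBundle (𝓡 n) ∞ (EuclideanSpace ℝ (Fin n))
  (fun x : M ↦ TangentSpace (𝓡 n) x)] in
theorem solutions_eq_image {Z₀ : VField n M} (hZ₀ : Z₀ ∈ solutions U X Y h) :
    solutions U X Y h = (fun E ↦ Z₀ + E) '' orthogonalFields U X Y := by
  ext Z
  constructor
  · exact fun hZ ↦ ⟨Z - Z₀, sub_mem_orthogonalFields hZ hZ₀, add_sub_cancel _ _⟩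
  · rintro ⟨E, hE, rfl⟩
    exact add_mem_solutions hZ₀ hE

omit [IsContMDiffRiemannianBundle (𝓡 n) ∞ (EuclideanSpace ℝ (Fin n))
  (fun x : M ↦ TangentSpace (𝓡 n) x)] in
-- The equations at `x` involve only the value `Z x`, so agreeing at each point with some solution
-- suffices.
theorem mem_solutions_iff (Z : VField n M) : Z ∈ solutions U X Y h ↔
    IsSmoothOn U Z ∧ ∀ x ∈ U, Z x ∈ fiberAt (solutions U X Y h) x := by
  refine ⟨fun hZ ↦ ⟨hZ.1, fun x _ ↦ ⟨Z, hZ, rfl⟩⟩, fun ⟨hZ, hfib⟩ ↦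
    ⟨hZ, fun i x hx ↦ ?_, fun j x hx ↦ ?_⟩⟩ <;> obtain ⟨Z', hZ', hZZ'⟩ := hfib x hx
  · rw [← hZZ']; exact hZ'.2.1 i x hx
  · rw [← hZZ']; exact hZ'.2.2 j x hx

theorem isLocalGenerators_solutions [T2Space M] (hkp : k + p < n) (hU : IsOpen U)
    (hh : ∀ j, ContMDiffOn (𝓡 n) 𝓘(ℝ) ∞ (h j) U)
    (hX : ∀ i, IsSmoothOn U (X i)) (hY : ∀ j, IsSmoothOn U (Y j))
    (hXY : ∀ x ∈ U, LinearIndependent ℝ (Sum.elim (fun i ↦ X i x) (fun j ↦ Y j x)))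
    (o : PointwiseOrientation n M) {W : Set M} (hW : IsOpen W) (hWU : W ⊆ U)
    {o' : PointwiseOrientation n M} (ho' : IsOrientationOn W o')
    {Z : Fin (n - (k + p)) → VField n M} (hs : IsMovingFrame W (Sum.elim X (Sum.elim Y Z))) :
    IsLocalGenerators (solutions U X Y h) W (baseField o hkp X Y h)
      (directionField o' hkp X Y Z) := by
  have hbase := baseField_mem_solutions hkp hU hh hX hY hXY o
  have hspan (y : M) (hy : y ∈ W) : ⊤ ≤ Submodule.span ℝ (Set.range (Sum.elim (fun i ↦ X i y)
      (Sum.elim (fun j ↦ Y j y) fun b ↦ Z b y))) := by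
    have hev : (fun i ↦ Sum.elim X (Sum.elim Y Z) i y) = Sum.elim (fun i ↦ X i y)
        (Sum.elim (fun j ↦ Y j y) fun b ↦ Z b y) := by
      ext (i | j | b) <;> rfl
    rw [← hev]
    exact hs.generating hy
  refine ⟨hbase.1.mono hWU, isSmoothOn_directionField hkp hW (fun i ↦ (hX i).mono hWU)
    (fun j ↦ (hY j).mono hWU) (fun b ↦ hs.contMDiffOn (Sum.inr (Sum.inr b))) ho',
    fun y hy ↦ linearIndependent_direction (o' y) hkp (hspan y hy), fun y hy ↦ ?_⟩
  have hmem := mem_span_direction_iff (o' y) hkp (hXY y (hWU hy)) (hspan y hy)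
  ext u
  constructor
  · rintro ⟨S, hS, rfl⟩
    have hSb := sub_mem_orthogonalFields hS hbase
    exact ⟨(S - baseField o hkp X Y h) y, (hmem _).2
      ⟨fun i ↦ hSb.2.1 i y (hWU hy), fun j ↦ hSb.2.2 j y (hWU hy)⟩, add_sub_cancel _ _⟩
  · rintro ⟨d, hd, rfl⟩
    obtain ⟨hdX, hdY⟩ := (hmem d).1 hd
    obtain ⟨E, hE, hEy⟩ := exists_mem_orthogonalFields hU hX hY hXY hkp o hdX hdY
    exact ⟨baseField o hkp X Y h + E, add_mem_solutions hbase hE, by simp [hEy]⟩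

end Solutions

end AffineDist

end

theorem theorem3p3 {n k p : ℕ} (hk : 0 < k) (hp : 1 < p) (hkp : k + p < n - 1)
    {M : Type*} [TopologicalSpace M] [T2Space M]
    [ChartedSpace (EuclideanSpace ℝ (Fin n)) M] [IsManifold (𝓡 n) ∞ M]
    [RiemannianBundle (fun x : M ↦ TangentSpace (𝓡 n) x)]
    [IsContMDiffRiemannianBundle (𝓡 n) ∞ (EuclideanSpace ℝ (Fin n))
      (fun x : M ↦ TangentSpace (𝓡 n) x)]
    (U : Set M) (hU : IsOpen U)
    (h : Fin p → M → ℝ) (h_smooth : ∀ j, ContMDiffOn (𝓡 n) 𝓘(ℝ) ∞ (h j) U)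
    (h_ne : ∀ j, ∃ x ∈ U, h j x ≠ 0)
    (X : Fin k → AffineDist.VField n M) (Y : Fin p → AffineDist.VField n M)
    (hX : ∀ i, AffineDist.IsSmoothOn U (X i)) (hY : ∀ j, AffineDist.IsSmoothOn U (Y j))
    (hXY : ∀ x ∈ U, LinearIndependent ℝ (Sum.elim (fun i ↦ X i x) (fun j ↦ Y j x)))
    (o : AffineDist.PointwiseOrientation n M) :
    AffineDist.solutions U X Y h =
        (fun Z ↦ AffineDist.baseField o (by omega) X Y h + Z) ''
          AffineDist.orthogonalFields U X Y ∧
      AffineDist.IsSmoothAffineDistribution (n - (k + p)) U (AffineDist.solutions U X Y h) ∧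
      (∀ W : Set M, IsOpen W → W ⊆ U →
        ∀ o' : AffineDist.PointwiseOrientation n M, AffineDist.IsOrientationOn W o' →
        ∀ Z : Fin (n - (k + p)) → AffineDist.VField n M,
          AffineDist.IsMovingFrame W (Sum.elim X (Sum.elim Y Z)) →
          AffineDist.IsLocalGenerators (AffineDist.solutions U X Y h) W
            (AffineDist.baseField o (by omega) X Y h)
            (AffineDist.directionField o' (by omega) X Y Z)) ∧
      (∀ x ∈ U, ∃ W : Set M, IsOpen W ∧ x ∈ W ∧ W ⊆ U ∧
        (∃ o' : AffineDist.PointwiseOrientation n M, AffineDist.IsOrientationOn W o') ∧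
        ∃ Z : Fin (n - (k + p)) → AffineDist.VField n M,
          AffineDist.IsMovingFrame W (Sum.elim X (Sum.elim Y Z))) := by

  have hkp' : k + p < n := by omega
  have hlocal : ∀ x ∈ U, ∃ W : Set M, IsOpen W ∧ x ∈ W ∧ W ⊆ U ∧
      (∃ o' : AffineDist.PointwiseOrientation n M, AffineDist.IsOrientationOn W o') ∧
      ∃ Z : Fin (n - (k + p)) → AffineDist.VField n M,
        AffineDist.IsMovingFrame W (Sum.elim X (Sum.elim Y Z)) := fun x hx ↦ by
    obtain ⟨W, hW, hxW, hWU, Z, hs⟩ :=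
      AffineDist.exists_movingFrame_completion hU hX hY hXY hkp' hx
    refine ⟨W, hW, hxW, hWU, AffineDist.exists_isOrientationOn hW hs ?_ o, Z, hs⟩
    simp only [Fintype.card_sum, Fintype.card_fin]
    omega
  refine ⟨AffineDist.solutions_eq_image
      (AffineDist.baseField_mem_solutions hkp' hU h_smooth hX hY hXY o),
    ⟨AffineDist.mem_solutions_iff, fun x hx ↦ ?_⟩,
    fun W hW hWU o' ho' Z hs ↦ AffineDist.isLocalGenerators_solutions hkp' hU h_smooth hX hY hXY
      o hW hWU ho' hs, hlocal⟩
  obtain ⟨W, hW, hxW, hWU, ⟨o', ho'⟩, Z, hs⟩ := hlocal x hx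
  exact ⟨W, hW, hxW, hWU, _, _, AffineDist.isLocalGenerators_solutions hkp' hU h_smooth hX hY hXY
    o hW hWU ho' hs⟩
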